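/- Let $X$ be a sigma-finite measure space and let $H$ and $M$ be self-adjoint, non-negative (possibly unbounded) operators in $L_2(X)=L_2(X;\mathbb C)$ such that for every $f\in L_2(X)$ and every $t>0$ $$|(e^{-tM}f)(x)|\le (e^{-tH}|f|)(x)\qquad\text{for a.e. }x\in X.$$ For a self-adjoint non-negative operator $A$ and $\lambda,\gamma\ge0$ let $\mathrm{tr}(A-\lambda)_-^\gamma\in[0,\infty]$ be the trace of the operator $(A-\lambda)_-^\gamma$ defined by the functional calculus, where $s_-=\max\{-s,0\}$; for $\gamma=0$, $(A-\lambda)_-^0$ is the spectral projection of $A$ for the interval $(-\infty,\lambda)$. Suppose that for some real numbers $\alpha\ge\gamma\ge0$ and $C>0$ one has $$\mathrm{tr}(H-\lambda)_-^\gamma\le C\lambda^\alpha\qquad\text{for all }\lambda\ge0.$$ Then $$\mathrm{tr}(M-\lambda)_-^\gamma\le C\left(\frac{\gamma}{e}\right)^{\gamma}\left(\frac{e}{\alpha}\right)^{\alpha}\frac{\Gamma(\alpha+1)}{\Gamma(\gamma+1)}\,\lambda^\alpha\qquad\text{for all }\lambda\ge0,$$ with the conventions $(\gamma/e)^\gamma=1$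 if $\gamma=0$, $(e/\alpha)^\alpha=1$ if $\alpha=0$, and $0^0=1$ for $\lambda^\alpha$. -/

import Mathlib

open MeasureTheory
open scoped ENNReal

noncomputable section

namespace SemigroupDomination

section Hilbert

variable {E : Type*} [NormedAddCommGroup E] [InnerProductSpace ℂ E] [CompleteSpace E]

/-- An (unbounded) operator `H` is non-negative: `⟨u, H u⟩ ≥ 0` for all `u` in its domain. -/
def IsNonneg (H : E →ₗ.[ℂ] E) : Prop :=
  ∀ u : H.domain, 0 ≤ (inner ℂ (u : E) (H u)).re

/-- `R` is the bounded operator `(1 + H)⁻¹`: for every `f`, the vector `u = R f` lies in the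
domain of `H` and satisfies `u + H u = f`. -/
def IsResolvent (H : E →ₗ.[ℂ] E) (R : E →L[ℂ] E) : Prop :=
  ∀ f : E, ∃ u : H.domain, (u : E) = R f ∧ (u : E) + H u = f

/-- For a non-negative operator one has `‖u‖ ≤ ‖u + H u‖`. -/
theorem norm_le_norm_add {H : E →ₗ.[ℂ] E} (h0 : IsNonneg H) (u : H.domain) :
    ‖(u : E)‖ ≤ ‖(u : E) + H u‖ := by
  have h1 : ‖(u : E)‖ ^ 2 ≤ (inner ℂ (u : E) ((u : E) + H u)).re := by
    rw [inner_add_right, Complex.add_re]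
    have h2 := h0 u
    have h3 : (inner ℂ (u : E) (u : E)).re = ‖(u : E)‖ ^ 2 := by
      have := inner_self_eq_norm_sq (𝕜 := ℂ) (u : E)
      simpa using this
    linarith
  have h4 : (inner ℂ (u : E) ((u : E) + H u)).re ≤ ‖(u : E)‖ * ‖(u : E) + H u‖ :=
    (Complex.re_le_norm _).trans (norm_inner_le_norm _ _)
  by_contra hlt
  push Not at hlt
  have h5 : 0 ≤ ‖(u : E) + H u‖ := norm_nonneg _
  nlinarith

/-- The operator `(1 + H)⁻¹` exists and is unique if `H` is self-adjoint and non-negative. -/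
theorem existsUnique_isResolvent {H : E →ₗ.[ℂ] E} (hH : IsSelfAdjoint H) (h0 : IsNonneg H) :
    ∃! R : E →L[ℂ] E, IsResolvent H R := by
  have hdense : Dense (H.domain : Set E) := hH.dense_domain
  let A : H.domain →ₗ[ℂ] E := H.domain.subtype + H.toFun
  have hA : ∀ u : H.domain, A u = (u : E) + H u := fun u => rfl
  have hinj : Function.Injective A := by
    rw [← LinearMap.ker_eq_bot, LinearMap.ker_eq_bot']
    intro u hu
    have h := norm_le_norm_add h0 u
    rw [← hA, hu, norm_zero] at h
    exact Subtype.ext (norm_le_zero_iff.mp h)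
  have hclosed : IsClosed (LinearMap.range A : Set E) := by
    rw [← isSeqClosed_iff_isClosed]
    intro y f hy hlim
    choose u hu using hy
    have hc : CauchySeq (fun n => ((u n : H.domain) : E)) := by
      have hy' : CauchySeq y := hlim.cauchySeq
      rw [Metric.cauchySeq_iff] at hy' ⊢
      intro ε hε
      obtain ⟨N, hN⟩ := hy' ε hε
      refine ⟨N, fun m hm n hn => lt_of_le_of_lt ?_ (hN m hm n hn)⟩
      have h := norm_le_norm_add h0 (u m - u n)
      rw [← hA, map_sub, hu, hu] at h
      rw [dist_eq_norm, dist_eq_norm]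
      simpa using h
    obtain ⟨v, hv⟩ := cauchySeq_tendsto_of_complete hc
    have hHu : Filter.Tendsto (fun n => H (u n)) Filter.atTop (nhds (f - v)) := by
      have h := hlim.sub hv
      refine h.congr fun n => ?_
      rw [← hu n, hA]
      abel
    have hcl : IsClosed (H.graph : Set (E × E)) := hH.isClosed
    have hmem : (v, f - v) ∈ H.graph :=
      hcl.mem_of_tendsto (hv.prodMk_nhds hHu)
        (Filter.Eventually.of_forall fun n => H.mem_graph (u n))
    obtain ⟨w, hw1, hw2⟩ := (LinearPMap.mem_graph_iff H).mp hmem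
    refine ⟨w, ?_⟩
    rw [hA]
    simp only at hw1 hw2
    rw [hw1, hw2]
    abel
  have hsurj : Function.Surjective A := by
    have hcomp : IsComplete (LinearMap.range A : Set E) := hclosed.isComplete
    have : CompleteSpace (LinearMap.range A) := hcomp.completeSpace_coe
    rw [← LinearMap.range_eq_top, ← Submodule.orthogonal_eq_bot_iff, Submodule.eq_bot_iff]
    intro w hw
    have hw' : ∀ u : H.domain, inner ℂ w (H u) = - inner ℂ w (u : E) := by
      intro u
      have h : inner ℂ w (A u) = 0 :=
        (Submodule.mem_orthogonal' _ _).mp hw _ (LinearMap.mem_range_self A u)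
      rw [hA, inner_add_right] at h
      exact eq_neg_of_add_eq_zero_right h
    have hw2 : ∀ u : H.domain, inner ℂ (-w) (u : E) = inner ℂ w (H u) := by
      intro u
      rw [hw', inner_neg_left]
    have hwd : w ∈ H.adjoint.domain := LinearPMap.mem_adjoint_domain_of_exists w ⟨-w, hw2⟩
    have hval : H.adjoint ⟨w, hwd⟩ = -w := LinearPMap.adjoint_apply_eq hdense ⟨w, hwd⟩ hw2
    have hle : H.adjoint ≤ H := le_of_eq (LinearPMap.isSelfAdjoint_def.mp hH)
    have hHw : H ⟨w, hle.1 hwd⟩ = -w := by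
      rw [← hval]
      exact (hle.2 rfl).symm
    have h := norm_le_norm_add h0 ⟨w, hle.1 hwd⟩
    rw [hHw] at h
    simpa using h
  let e : H.domain ≃ₗ[ℂ] E := LinearEquiv.ofBijective A ⟨hinj, hsurj⟩
  have he : ∀ f : E, ((e.symm f : H.domain) : E) + H (e.symm f) = f := fun f =>
    e.apply_symm_apply f
  let R : E →L[ℂ] E := LinearMap.mkContinuous (H.domain.subtype ∘ₗ e.symm.toLinearMap) 1 (by
    intro f
    have h := norm_le_norm_add h0 (e.symm f)
    rw [he] at h
    simpa using h)
  refine ⟨R, fun f => ⟨e.symm f, rfl, he f⟩, ?_⟩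
  intro S hS
  ext f
  obtain ⟨u, hu1, hu2⟩ := hS f
  have : e.symm f = u := by
    rw [LinearEquiv.symm_apply_eq]
    exact hu2.symm
  rw [← hu1, ← this]
  rfl

open Classical in
/-- The bounded operator `(1 + H)⁻¹` of a self-adjoint, non-negative operator `H`. -/
def inverseOneAdd (H : E →ₗ.[ℂ] E) : E →L[ℂ] E :=
  if h : ∃ R : E →L[ℂ] E, IsResolvent H R then h.choose else 0

theorem isResolvent_inverseOneAdd {H : E →ₗ.[ℂ] E} (hH : IsSelfAdjoint H) (h0 : IsNonneg H) :
    IsResolvent H (inverseOneAdd H) := by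
  have h : ∃ R : E →L[ℂ] E, IsResolvent H R := (existsUnique_isResolvent hH h0).exists
  rw [inverseOneAdd, dif_pos h]
  exact h.choose_spec

/-- Functional calculus: the bounded operator `φ(H)`, for `H` self-adjoint and non-negative and
`φ` continuous on `[0, ∞)` and vanishing at infinity. Here `H` and its bounded inverse
`R = (1 + H)⁻¹` determine each other through the change of the spectral variable
`r = 1 / (1 + s)`, that is, `s = 1 / r - 1`; so `φ(H) = g(R)` with `g(r) = φ(1 / r - 1)` for
`0 < r ≤ 1`, and `g(0) = 0` is the limit of `φ` at infinity. -/
def functionOf (H : E →ₗ.[ℂ] E) (φ : ℝ → ℝ) : E →L[ℂ] E :=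
  cfc (fun r : ℝ => if r = 0 then 0 else φ (1 / r - 1)) (inverseOneAdd H)

/-- The heat operator `exp(-tH)`, for `t > 0`. -/
def heat (H : E →ₗ.[ℂ] E) (t : ℝ) : E →L[ℂ] E :=
  functionOf H (fun s => Real.exp (-(t * s)))

/-- The spectral subspace of `H` for the interval `(-∞, lam)`. It is the closure of the range of
the negative part `(H - lam)₋`, since the function `s ↦ (s - lam)₋ = max (lam - s) 0` is positive
exactly on `(-∞, lam)`. -/
def spectralSubspaceBelow (H : E →ₗ.[ℂ] E) (lam : ℝ) : Submodule ℂ E :=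
  (LinearMap.range (functionOf H (fun s => max (lam - s) 0)).toLinearMap).topologicalClosure

instance instCompleteSpaceSpectralSubspaceBelow (H : E →ₗ.[ℂ] E) (lam : ℝ) :
    CompleteSpace (spectralSubspaceBelow H lam) :=
  (Submodule.isClosed_topologicalClosure _).completeSpace_coe

open Classical in
/-- The operator `(H - lam)₋ ^ γ`, for `γ ≥ 0`, where `s₋ = max (-s) 0`. For `γ = 0` it is the
spectral projection of `H` for the interval `(-∞, lam)`, whose trace is the number of eigenvalues
below `lam` (with the convention that `s₋ ^ 0` is `1` for `s < 0` and `0` for `s ≥ 0`). -/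
def negPartPow (H : E →ₗ.[ℂ] E) (lam γ : ℝ) : E →L[ℂ] E :=
  if γ = 0 then (spectralSubspaceBelow H lam).starProjection
  else functionOf H (fun s => (max (lam - s) 0) ^ γ)

/-- The trace, in `[0, ∞]`, of a bounded positive operator `T`: the sum of `⟨e, T e⟩` over the
vectors `e` of an orthonormal basis. -/
def trace (T : E →L[ℂ] E) : ℝ≥0∞ :=
  ∑' e : (exists_hilbertBasis ℂ E).choose, ENNReal.ofReal (inner ℂ (e : E) (T e)).re

theorem ofReal_norm_sq_eq_tsum {ι : Type*} (c : HilbertBasis ι ℂ E) (x : E) :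
    ENNReal.ofReal (‖x‖ ^ 2) = ∑' k, ENNReal.ofReal (‖(inner ℂ (c k) x : ℂ)‖ ^ 2) := by
  rw [← ENNReal.ofReal_tsum_of_nonneg (fun k => sq_nonneg _)
    (c.orthonormal.inner_products_summable x)]
  congr 1
  have h := c.tsum_inner_mul_inner x x
  have h2 : ∀ k, inner ℂ x (c k) * inner ℂ (c k) x
      = ((‖(inner ℂ (c k) x : ℂ)‖ ^ 2 : ℝ) : ℂ) := by
    intro k
    rw [← inner_conj_symm, mul_comm, Complex.mul_conj, Complex.normSq_eq_norm_sq]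
  simp only [h2] at h
  rw [← Complex.ofReal_tsum, inner_self_eq_norm_sq_to_K] at h
  apply Complex.ofReal_injective
  rw [h]
  simp

/-- The trace of a positive operator does not depend on the orthonormal basis. -/
theorem trace_eq_tsum {T : E →L[ℂ] E} (hT : T.IsPositive) {ι : Type*} (b : HilbertBasis ι ℂ E) :
    trace T = ∑' i, ENNReal.ofReal (inner ℂ (b i) (T (b i))).re := by
  have hnn : 0 ≤ T := (ContinuousLinearMap.nonneg_iff_isPositive T).mpr hT
  obtain ⟨S, hS, hST⟩ : ∃ S : E →L[ℂ] E, IsSelfAdjoint S ∧ S * S = T :=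
    ⟨CFC.sqrt T, (CFC.sqrt_nonneg T).isSelfAdjoint, CFC.sqrt_mul_sqrt_self T hnn⟩
  have hsymm : ∀ x y : E, inner ℂ (S x) y = inner ℂ x (S y) := fun x y =>
    (ContinuousLinearMap.isSelfAdjoint_iff_isSymmetric.mp hS) x y
  have hTS : ∀ x : E, (inner ℂ x (T x)).re = ‖S x‖ ^ 2 := by
    intro x
    rw [← hST, mul_apply_eq_comp, ← hsymm]
    have := inner_self_eq_norm_sq (𝕜 := ℂ) (S x)
    simpa using this
  obtain ⟨c, hc⟩ := (exists_hilbertBasis ℂ E).choose_spec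
  unfold trace
  have hce : ∀ e : (exists_hilbertBasis ℂ E).choose, (e : E) = c e := fun e => by rw [hc]
  simp only [hce, hTS]
  rw [tsum_congr fun e => ofReal_norm_sq_eq_tsum b (S (c e)), ENNReal.tsum_comm,
    tsum_congr fun i => ofReal_norm_sq_eq_tsum c (S (b i))]
  refine tsum_congr fun i => tsum_congr fun e => ?_
  rw [← hsymm, norm_inner_symm]

end Hilbert

section L2

variable {X : Type*} [MeasurableSpace X] {μ : Measure X}

/-- The pointwise absolute value `|f|` of `f ∈ L²(X; ℂ)`, again as an element of `L²(X; ℂ)`. -/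
def absL2 (f : Lp ℂ 2 μ) : Lp ℂ 2 μ :=
  MemLp.toLp (fun x => ((‖f x‖ : ℝ) : ℂ)) (Lp.memLp f).norm.ofReal

/-- The semigroup of `H` is positivity preserving and dominates that of `M`: for all `t > 0` and
`f ∈ L²(X)`, almost everywhere `|exp(-tM) f| ≤ exp(-tH) |f|`. The right-hand side is a
priori complex valued; the inequality includes that it is real. -/
def Dominates (H M : Lp ℂ 2 μ →ₗ.[ℂ] Lp ℂ 2 μ) : Prop :=
  ∀ (f : Lp ℂ 2 μ) (t : ℝ), 0 < t → ∀ᵐ x ∂μ,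
    (heat H t (absL2 f) x).im = 0 ∧ ‖heat M t f x‖ ≤ (heat H t (absL2 f) x).re

end L2

end SemigroupDomination

end

/-! The estimate passes through heat traces. The Laplace identity `∫₀^∞ e^{-tl} (l - s)₊^γ dl =
Γ(γ+1) t^{-γ-1} e^{-ts}`, inserted into the functional calculus, turns the bound on `tr (H - l)₋^γ`
into `tr e^{-tH} ≤ C Γ(α+1)/Γ(γ+1) t^{γ-α}` (`trace_heat_le`). Domination gives `tr e^{-tM} ≤ tr
e^{-tH}` (`trace_heat_le_of_dominates`). The pointwise bound `(lam - s)₊^γ ≤ e^{t lam} (γ/e)^γ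
t^{-γ} e^{-ts}` leads back from the heat trace to `tr (M - lam)₋^γ`
(`trace_negPartPow_le_trace_heat`). Together these bound the trace by a constant times `e^{t lam}
t^{-α}`, which is minimal at `t = α / lam`.

For the comparison of heat traces, domination controls the diagonal entry at `e` when `|e| = e`.
Normalized indicators of disjoint sets have this property, are orthonormal, and have spans that
approximate any finite family in `L²`; compressing to such a span suffices
(`trace_le_trace_of_approx`).

For `γ = 0` the spectral projection is not a continuous function of the operator. It is handled
through its range `K`, whose complement is the kernel of `(H - lam)₋`: for `H` by comparison with
small exponents `η → 0` (`negPartPow_form_le`), for `M` by a direct form bound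
(`spectralProjection_form_le`). -/

namespace SemigroupDomination

/-! ### Functional calculus through the bounded inverse `(1 + H)⁻¹`. -/

section Hilbert

variable {E : Type*} [NormedAddCommGroup E] [InnerProductSpace ℂ E] [CompleteSpace E]

/-- The function of `r = 1 / (1 + s)` corresponding to a function `φ` of `s`, with value `0` at
`r = 0`, that is, at `s = ∞`. -/
noncomputable def pullback (φ : ℝ → ℝ) (r : ℝ) : ℝ := if r = 0 then 0 else φ (1 / r - 1)

theorem functionOf_eq (H : E →ₗ.[ℂ] E) (φ : ℝ → ℝ) :
    functionOf H φ = cfc (pullback φ) (inverseOneAdd H) := rfl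

theorem inner_apply_comm {H : E →ₗ.[ℂ] E} (hH : IsSelfAdjoint H) (u v : H.domain) :
    inner ℂ (H u) (v : E) = inner ℂ (u : E) (H v) := by
  have h := LinearPMap.adjoint_isFormalAdjoint (T := H) hH.dense_domain
  have he : H.adjoint = H := LinearPMap.isSelfAdjoint_def.mp hH
  rw [he] at h
  exact h u v

theorem isSelfAdjoint_inverseOneAdd {H : E →ₗ.[ℂ] E} (hH : IsSelfAdjoint H) (h0 : IsNonneg H) :
    IsSelfAdjoint (inverseOneAdd H) := by
  rw [ContinuousLinearMap.isSelfAdjoint_iff_isSymmetric]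
  intro f g
  obtain ⟨u, hu, hu'⟩ := isResolvent_inverseOneAdd hH h0 f
  obtain ⟨v, hv, hv'⟩ := isResolvent_inverseOneAdd hH h0 g
  change inner ℂ (inverseOneAdd H f) g = inner ℂ f (inverseOneAdd H g)
  rw [← hu, ← hv]
  conv_lhs => rw [← hv']
  conv_rhs => rw [← hu']
  rw [inner_add_right, inner_add_left, inner_apply_comm hH]

omit [CompleteSpace E] in
theorem re_inner_self_nonneg (u : E) : 0 ≤ (inner ℂ u u).re := by
  have := inner_self_nonneg (𝕜 := ℂ) (x := u)
  simpa using this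

theorem inverseOneAdd_nonneg {H : E →ₗ.[ℂ] E} (hH : IsSelfAdjoint H) (h0 : IsNonneg H) :
    0 ≤ inverseOneAdd H := by
  rw [ContinuousLinearMap.nonneg_iff_isPositive]
  refine ⟨ContinuousLinearMap.isSelfAdjoint_iff_isSymmetric.mp
    (isSelfAdjoint_inverseOneAdd hH h0), fun f => ?_⟩
  obtain ⟨u, hu, hu'⟩ := isResolvent_inverseOneAdd hH h0 f
  change 0 ≤ (inner ℂ (inverseOneAdd H f) f).re
  rw [← hu]
  conv_rhs => rw [← hu']
  rw [inner_add_right, Complex.add_re]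
  exact add_nonneg (re_inner_self_nonneg _) (h0 u)

theorem inverseOneAdd_le_one {H : E →ₗ.[ℂ] E} (hH : IsSelfAdjoint H) (h0 : IsNonneg H) :
    inverseOneAdd H ≤ 1 := by
  rw [ContinuousLinearMap.le_def]
  refine ⟨ContinuousLinearMap.isSelfAdjoint_iff_isSymmetric.mp
    ((IsSelfAdjoint.one _).sub (isSelfAdjoint_inverseOneAdd hH h0)), fun f => ?_⟩
  obtain ⟨u, hu, hu'⟩ := isResolvent_inverseOneAdd hH h0 f
  change 0 ≤ (inner ℂ (f - inverseOneAdd H f) f).re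
  rw [← hu]
  have h : f - (u : E) = H u := by rw [← hu']; abel
  rw [h]
  conv_rhs => rw [← hu']
  rw [inner_add_right, Complex.add_re, inner_apply_comm hH]
  exact add_nonneg (h0 u) (re_inner_self_nonneg _)

theorem spectrum_inverseOneAdd_subset {H : E →ₗ.[ℂ] E} (hH : IsSelfAdjoint H)
    (h0 : IsNonneg H) : spectrum ℝ (inverseOneAdd H) ⊆ Set.Icc 0 1 := by
  intro r hr
  refine ⟨spectrum_nonneg_of_nonneg (inverseOneAdd_nonneg hH h0) hr, ?_⟩
  have h := (le_algebraMap_iff_spectrum_le (R := ℝ) (r := 1)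
    (ha := isSelfAdjoint_inverseOneAdd hH h0)).mp
    (by simpa using inverseOneAdd_le_one hH h0)
  exact h r hr

omit [CompleteSpace E] in
/-- The operator inequality as an inequality between quadratic forms. -/
theorem re_inner_le_of_le {S T : E →L[ℂ] E} (h : S ≤ T) (u : E) :
    (inner ℂ u (S u)).re ≤ (inner ℂ u (T u)).re := by
  have h1 := ((ContinuousLinearMap.le_def S T).mp h).re_inner_nonneg_right u
  change 0 ≤ (inner ℂ u (T u - S u)).re at h1
  rw [inner_sub_right, Complex.sub_re] at h1
  linarith

theorem pullback_le {φ ψ : ℝ → ℝ} (h : ∀ s, 0 ≤ s → φ s ≤ ψ s) {r : ℝ}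
    (hr : r ∈ Set.Icc (0 : ℝ) 1) : pullback φ r ≤ pullback ψ r := by
  unfold pullback
  split_ifs with h1
  · exact le_rfl
  · refine h _ ?_
    have : 0 < r := lt_of_le_of_ne hr.1 (Ne.symm h1)
    rw [sub_nonneg, le_div_iff₀ this]
    linarith [hr.2]

theorem functionOf_mono {H : E →ₗ.[ℂ] E} (hH : IsSelfAdjoint H) (h0 : IsNonneg H)
    {φ ψ : ℝ → ℝ} (hφ : ContinuousOn (pullback φ) (Set.Icc 0 1))
    (hψ : ContinuousOn (pullback ψ) (Set.Icc 0 1)) (h : ∀ s, 0 ≤ s → φ s ≤ ψ s) :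
    functionOf H φ ≤ functionOf H ψ := by
  have hs := spectrum_inverseOneAdd_subset hH h0
  exact cfc_mono (fun r hr => pullback_le h (hs hr)) (hφ.mono hs) (hψ.mono hs)

/-- Continuity of `φ` is not needed: `cfc` is `0` by convention on functions that are not continuous
on the spectrum. -/
theorem isPositive_functionOf {H : E →ₗ.[ℂ] E} (hH : IsSelfAdjoint H) (h0 : IsNonneg H)
    {φ : ℝ → ℝ} (h : ∀ s, 0 ≤ s → 0 ≤ φ s) : (functionOf H φ).IsPositive := by
  rw [← ContinuousLinearMap.nonneg_iff_isPositive]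
  refine cfc_nonneg fun r hr => ?_
  have h1 := pullback_le (φ := fun _ => 0) (ψ := φ) h (spectrum_inverseOneAdd_subset hH h0 hr)
  refine le_trans ?_ h1
  simp [pullback]

theorem pullback_mul (φ ψ : ℝ → ℝ) :
    (pullback fun s => φ s * ψ s) = fun r => pullback φ r * pullback ψ r := by
  ext r
  unfold pullback
  split_ifs <;> simp

theorem pullback_const_mul (c : ℝ) (φ : ℝ → ℝ) :
    (pullback fun s => c * φ s) = fun r => c * pullback φ r := by
  ext r
  unfold pullback
  split_ifs <;> simp

theorem continuousOn_pullback_mul {φ ψ : ℝ → ℝ} {s : Set ℝ} (hφ : ContinuousOn (pullback φ) s)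
    (hψ : ContinuousOn (pullback ψ) s) : ContinuousOn (pullback fun x => φ x * ψ x) s := by
  rw [pullback_mul]
  exact hφ.mul hψ

theorem continuousOn_pullback_const_mul (c : ℝ) {φ : ℝ → ℝ} {s : Set ℝ}
    (hφ : ContinuousOn (pullback φ) s) : ContinuousOn (pullback fun x => c * φ x) s := by
  rw [pullback_const_mul]
  exact hφ.const_mul c

theorem functionOf_mul {H : E →ₗ.[ℂ] E} (hH : IsSelfAdjoint H) (h0 : IsNonneg H)
    {φ ψ : ℝ → ℝ} (hφ : ContinuousOn (pullback φ) (Set.Icc 0 1))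
    (hψ : ContinuousOn (pullback ψ) (Set.Icc 0 1)) :
    functionOf H (fun s => φ s * ψ s) = functionOf H φ * functionOf H ψ := by
  have hs := spectrum_inverseOneAdd_subset hH h0
  rw [functionOf_eq, functionOf_eq, functionOf_eq, ← cfc_mul _ _ _ (hφ.mono hs) (hψ.mono hs),
    pullback_mul]

theorem functionOf_const_mul {H : E →ₗ.[ℂ] E} (hH : IsSelfAdjoint H) (h0 : IsNonneg H)
    (c : ℝ) {φ : ℝ → ℝ} (hφ : ContinuousOn (pullback φ) (Set.Icc 0 1)) :
    functionOf H (fun s => c * φ s) = c • functionOf H φ := by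
  have hs := spectrum_inverseOneAdd_subset hH h0
  rw [functionOf_eq, functionOf_eq, ← cfc_smul c _ _ (hφ.mono hs), pullback_const_mul]
  rfl

theorem continuousOn_pullback_exp {t : ℝ} (ht : 0 < t) :
    ContinuousOn (pullback fun s => Real.exp (-(t * s))) (Set.Icc 0 1) := by
  intro r hr
  rcases hr.1.eq_or_lt with h | h
  · subst h
    rw [← continuousWithinAt_sdiff_self]
    have hT : Filter.Tendsto (fun r : ℝ => Real.exp (-(t * (1 / r - 1))))
        (nhdsWithin 0 (Set.Ioi 0)) (nhds 0) := by
      refine Real.tendsto_exp_atBot.comp (Filter.tendsto_neg_atTop_atBot.comp ?_)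
      refine Filter.Tendsto.const_mul_atTop ht ?_
      refine Filter.tendsto_atTop_add_const_right _ _ ?_
      exact (tendsto_inv_nhdsGT_zero (𝕜 := ℝ)).congr fun x => (one_div x).symm
    have h2 : pullback (fun s => Real.exp (-(t * s))) 0 = 0 := by simp [pullback]
    unfold ContinuousWithinAt
    rw [h2]
    refine (hT.mono_left (nhdsWithin_mono _ ?_)).congr' ?_
    · rintro x ⟨hx, hx'⟩
      exact lt_of_le_of_ne hx.1 (Ne.symm hx')
    · filter_upwards [self_mem_nhdsWithin] with x hx
      have : x ≠ 0 := hx.2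
      simp [pullback, this]
  · refine ContinuousAt.continuousWithinAt ?_
    have h1 : ContinuousAt (fun r : ℝ => Real.exp (-(t * (1 / r - 1)))) r := by
      have := h.ne'
      fun_prop (disch := assumption)
    refine h1.congr ?_
    filter_upwards [lt_mem_nhds h] with x hx
    simp [pullback, hx.ne']

/-- If `r < 1 / (|lam| + 2)` then `s = 1 / r - 1 > lam`, so the function already vanishes there.
Cutting `r` off at this level thus changes nothing and removes the singularity of `1 / r`, leaving
an expression visibly continuous in `lam` and `r`. -/
theorem pullback_negPart_rpow {γ : ℝ} (hγ : 0 < γ) (lam : ℝ) {r : ℝ} (hr : 0 ≤ r) :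
    pullback (fun s => (max (lam - s) 0) ^ γ) r
      = (max (lam + 1 - 1 / max r (1 / (|lam| + 2))) 0) ^ γ := by
  have h2 : 0 < |lam| + 2 := by positivity
  have key : r < 1 / (|lam| + 2) →
      (max (lam + 1 - 1 / max r (1 / (|lam| + 2))) 0) ^ γ = 0 := by
    intro h
    rw [max_eq_right h.le, one_div_one_div, max_eq_right, Real.zero_rpow hγ.ne']
    linarith [le_abs_self lam]
  unfold pullback
  split_ifs with h0
  · rw [key]
    rw [h0]; positivity
  · have hr' : 0 < r := lt_of_le_of_ne hr (Ne.symm h0)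
    rcases lt_or_ge r (1 / (|lam| + 2)) with h | h
    · rw [key h]
      beta_reduce
      rw [max_eq_right, Real.zero_rpow hγ.ne']
      have : |lam| + 2 < 1 / r := by
        rw [lt_div_iff₀ hr']
        rw [lt_div_iff₀ h2] at h
        linarith
      linarith [le_abs_self lam]
    · rw [max_eq_left h]
      beta_reduce
      congr 2
      ring

/-- Joint continuity of `(s - lam)₋ ^ γ` in `lam` and the spectral variable `r = 1 / (1 + s)`. -/
theorem continuousOn_pullback_negPart_rpow_uncurry {γ : ℝ} (hγ : 0 < γ) :
    ContinuousOn (fun p : ℝ × ℝ => pullback (fun s => (max (p.1 - s) 0) ^ γ) p.2)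
      (Set.univ ×ˢ Set.Icc 0 1) := by
  have h : Continuous fun p : ℝ × ℝ =>
      (max (p.1 + 1 - 1 / max p.2 (1 / (|p.1| + 2))) 0) ^ γ := by
    refine Continuous.rpow_const ?_ fun _ => Or.inr hγ.le
    have h1 : ∀ p : ℝ × ℝ, |p.1| + 2 ≠ 0 := fun p => by positivity
    have h3 : ∀ p : ℝ × ℝ, max p.2 (1 / (|p.1| + 2)) ≠ 0 := fun p =>
      (lt_max_of_lt_right (by positivity)).ne'
    have h4 : Continuous fun p : ℝ × ℝ => max p.2 (1 / (|p.1| + 2)) :=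
      continuous_snd.max (continuous_const.div (by fun_prop) h1)
    exact ((continuous_fst.add continuous_const).sub
      (continuous_const.div h4 h3)).max continuous_const
  refine h.continuousOn.congr fun p hp => ?_
  exact pullback_negPart_rpow hγ p.1 hp.2.1

theorem continuousOn_pullback_negPart_rpow {γ : ℝ} (hγ : 0 < γ) (lam : ℝ) :
    ContinuousOn (pullback fun s => (max (lam - s) 0) ^ γ) (Set.Icc 0 1) :=
  (continuousOn_pullback_negPart_rpow_uncurry hγ).comp
    (f := fun r : ℝ => (lam, r)) (by fun_prop) fun _ hr => ⟨trivial, hr⟩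

theorem continuousOn_pullback_negPart (lam : ℝ) :
    ContinuousOn (pullback fun s => max (lam - s) 0) (Set.Icc 0 1) := by
  simpa using continuousOn_pullback_negPart_rpow one_pos lam

/-! ### Traces, compressions and comparison on approximating orthonormal sets. -/

/-- A quadratic form inequality yields an inequality between traces. -/
theorem trace_le_mul_trace {S T : E →L[ℂ] E} {c : ℝ} (hc : 0 ≤ c)
    (h : ∀ u, (inner ℂ u (S u)).re ≤ c * (inner ℂ u (T u)).re) :
    trace S ≤ ENNReal.ofReal c * trace T := by
  unfold trace
  rw [← ENNReal.tsum_mul_left]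
  refine ENNReal.tsum_le_tsum fun e => ?_
  rw [← ENNReal.ofReal_mul hc]
  exact ENNReal.ofReal_le_ofReal (h _)

omit [CompleteSpace E] in
theorem inner_conj_starProjection (K : Submodule ℂ E) [K.HasOrthogonalProjection]
    (T : E →L[ℂ] E) (x : E) :
    inner ℂ x ((K.starProjection ∘L T ∘L K.starProjection) x)
      = inner ℂ (K.starProjection x) (T (K.starProjection x)) := by
  simp only [ContinuousLinearMap.comp_apply]
  exact (Submodule.inner_starProjection_left_eq_right K x _).symm

/-- The trace of the compression of a positive operator to the span of an orthonormal set. -/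
theorem trace_conj_starProjection_span {T : E →L[ℂ] E} (hT : T.IsPositive) {v : Set E}
    (hv : Orthonormal ℂ ((↑) : v → E)) [(Submodule.span ℂ v).HasOrthogonalProjection] :
    trace ((Submodule.span ℂ v).starProjection ∘L T ∘L (Submodule.span ℂ v).starProjection)
      = ∑' x : v, ENNReal.ofReal (inner ℂ (x : E) (T x)).re := by
  -- The trace may be computed in a basis containing `v`: the projection fixes the vectors of `v`
  -- and annihilates the other basis vectors.
  obtain ⟨w, b, hvw, hb⟩ := hv.exists_hilbertBasis_extension
  rw [trace_eq_tsum (hT.conj_starProjection _) b]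
  simp only [inner_conj_starProjection, hb]
  have hin : ∀ x ∈ v, (Submodule.span ℂ v).starProjection x = x := fun x hx =>
    Submodule.starProjection_eq_self_iff.mpr (Submodule.subset_span hx)
  have hout : ∀ x ∈ w, x ∉ v → (Submodule.span ℂ v).starProjection x = 0 := by
    intro x hx hxv
    rw [Submodule.starProjection_apply_eq_zero_iff, Submodule.mem_orthogonal]
    intro u hu
    induction hu using Submodule.span_induction with
    | mem y hy =>
      have h := b.orthonormal.2 (i := ⟨y, hvw hy⟩) (j := ⟨x, hx⟩)
        (fun h => hxv ((show y = x from congrArg Subtype.val h) ▸ hy))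
      simpa [hb] using h
    | zero => simp
    | add y z _ _ hy hz => rw [inner_add_left, hy, hz, add_zero]
    | smul c y _ hy => rw [inner_smul_left, hy, mul_zero]
  rw [tsum_subtype w (fun x => ENNReal.ofReal
    (inner ℂ ((Submodule.span ℂ v).starProjection x)
      (T ((Submodule.span ℂ v).starProjection x))).re),
    tsum_subtype v (fun x => ENNReal.ofReal (inner ℂ x (T x)).re)]
  refine tsum_congr fun x => ?_
  by_cases hxv : x ∈ v
  · rw [Set.indicator_of_mem (hvw hxv), Set.indicator_of_mem hxv, hin x hxv]
  · rw [Set.indicator_of_notMem hxv]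
    by_cases hxw : x ∈ w
    · rw [Set.indicator_of_mem hxw, hout x hxw hxv]
      simp
    · rw [Set.indicator_of_notMem hxw]

theorem tsum_orthonormal_le_trace {T : E →L[ℂ] E} (hT : T.IsPositive) {v : Set E}
    (hv : Orthonormal ℂ ((↑) : v → E)) :
    ∑' x : v, ENNReal.ofReal (inner ℂ (x : E) (T x)).re ≤ trace T := by
  obtain ⟨w, b, hvw, hb⟩ := hv.exists_hilbertBasis_extension
  rw [trace_eq_tsum hT b]
  simp only [hb]
  exact ENNReal.tsum_mono_subtype (fun x => ENNReal.ofReal (inner ℂ x (T x)).re) hvw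

/-- If the diagonal entries of `T` are at most those of `S` for finite orthonormal subsets of a
class whose spans approximate every finite family of vectors, then `trace T ≤ trace S`. -/
theorem trace_le_trace_of_approx {S T : E →L[ℂ] E} (hS : S.IsPositive) (hT : T.IsPositive)
    {p : E → Prop} (hp : ∀ e, p e → (inner ℂ e (T e)).re ≤ (inner ℂ e (S e)).re)
    (happ : ∀ (F : Finset E) (ε : ℝ), 0 < ε →
      ∃ v : Set E, v.Finite ∧ Orthonormal ℂ ((↑) : v → E) ∧ (∀ e ∈ v, p e) ∧
        ∀ f ∈ F, ∃ g ∈ Submodule.span ℂ v, ‖f - g‖ < ε) :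
    trace T ≤ trace S := by
  by_cases htop : trace S = ⊤
  · rw [htop]; exact le_top
  rw [trace, ENNReal.tsum_eq_iSup_sum]
  refine iSup_le fun F => ?_
  have hpos : ∀ x, 0 ≤ (inner ℂ x (T x)).re := fun x => by
    simpa using hT.re_inner_nonneg_right x
  -- A finite diagonal sum depends continuously on its vectors, so the bound need only be shown for
  -- families arbitrarily close to the given one.
  have hcl : IsClosed {g : F → E | ∑ i, (inner ℂ (g i) (T (g i))).re ≤ (trace S).toReal} := by
    refine isClosed_le ?_ continuous_const
    fun_prop
  have hmem : (fun i : F => ((i : (exists_hilbertBasis ℂ E).choose) : E)) ∈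
      {g : F → E | ∑ i, (inner ℂ (g i) (T (g i))).re ≤ (trace S).toReal} := by
    rw [← hcl.closure_eq, Metric.mem_closure_iff]
    intro ε hε
    obtain ⟨v, hfin, hv, hvp, hvf⟩ := happ (F.map (Function.Embedding.subtype _)) ε hε
    have : FiniteDimensional ℂ (Submodule.span ℂ v) := FiniteDimensional.span_of_finite ℂ hfin
    refine ⟨fun i => (Submodule.span ℂ v).starProjection (i : E), ?_, ?_⟩
    · have h1 : ∑ i : F, ENNReal.ofReal (inner ℂ ((Submodule.span ℂ v).starProjection (i : E))
          (T ((Submodule.span ℂ v).starProjection (i : E)))).re ≤ trace S := by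
        calc _ ≤ trace ((Submodule.span ℂ v).starProjection ∘L T ∘L
              (Submodule.span ℂ v).starProjection) := by
              simp only [← inner_conj_starProjection]
              unfold trace
              rw [Finset.sum_coe_sort F (fun i => ENNReal.ofReal (inner ℂ (i : E)
                (((Submodule.span ℂ v).starProjection ∘L T ∘L
                  (Submodule.span ℂ v).starProjection) i)).re)]
              exact ENNReal.sum_le_tsum F
          _ = ∑' x : v, ENNReal.ofReal (inner ℂ (x : E) (T x)).re :=
              trace_conj_starProjection_span hT hv
          _ ≤ ∑' x : v, ENNReal.ofReal (inner ℂ (x : E) (S x)).re :=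
              ENNReal.tsum_le_tsum fun x => ENNReal.ofReal_le_ofReal (hp _ (hvp _ x.2))
          _ ≤ trace S := tsum_orthonormal_le_trace hS hv
      rw [← ENNReal.ofReal_sum_of_nonneg fun i _ => hpos _] at h1
      exact (ENNReal.ofReal_le_iff_le_toReal htop).mp h1
    · rw [dist_pi_lt_iff hε]
      intro i
      obtain ⟨g, hg, hgi⟩ := hvf i (Finset.mem_map_of_mem _ i.2)
      rw [dist_eq_norm]
      refine lt_of_le_of_lt ?_ hgi
      rw [Submodule.starProjection_minimal]
      exact ciInf_le ⟨0, by rintro _ ⟨x, rfl⟩; exact norm_nonneg _⟩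
        (⟨g, hg⟩ : Submodule.span ℂ v)
  rw [← Finset.sum_coe_sort, ← ENNReal.ofReal_sum_of_nonneg fun i _ => hpos _]
  exact (ENNReal.ofReal_le_iff_le_toReal htop).mpr hmem

end Hilbert

/-! ### From pointwise domination to the comparison of heat traces. -/

section L2

variable {X : Type*} [MeasurableSpace X] {μ : Measure X}

theorem re_inner_le_of_dominates {S T : Lp ℂ 2 μ →L[ℂ] Lp ℂ 2 μ} {f : Lp ℂ 2 μ}
    (h : ∀ᵐ x ∂μ, (S (absL2 f) x).im = 0 ∧ ‖T f x‖ ≤ (S (absL2 f) x).re) :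
    (inner ℂ f (T f)).re ≤ (inner ℂ (absL2 f) (S (absL2 f))).re := by
  rw [L2.inner_def, L2.inner_def]
  have h1 := L2.integrable_inner (𝕜 := ℂ) f (T f)
  have h2 := L2.integrable_inner (𝕜 := ℂ) (absL2 f) (S (absL2 f))
  have e1 := integral_re h1
  have e2 := integral_re h2
  simp only [RCLike.re_eq_complex_re] at e1 e2
  rw [← e1, ← e2]
  refine integral_mono_ae h1.re h2.re ?_
  have habs : absL2 f =ᵐ[μ] fun x => ((‖f x‖ : ℝ) : ℂ) := MemLp.coeFn_toLp _
  filter_upwards [h, habs] with x hx hfx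
  rw [hfx]
  calc (inner ℂ (f x) (T f x)).re ≤ ‖f x‖ * ‖T f x‖ :=
        (Complex.re_le_norm _).trans (norm_inner_le_norm _ _)
    _ ≤ ‖f x‖ * (S (absL2 f) x).re := by gcongr; exact hx.2
    _ = _ := by simp [mul_comm]

theorem absL2_indicatorConstLp {s : Set X} (hs : MeasurableSet s) (hμs : μ s ≠ ∞) {a : ℝ}
    (ha : 0 ≤ a) :
    absL2 (indicatorConstLp 2 hs hμs (a : ℂ)) = indicatorConstLp 2 hs hμs (a : ℂ) := by
  refine Lp.ext ?_
  have habs : absL2 (indicatorConstLp 2 hs hμs (a : ℂ)) =ᵐ[μ]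
    fun x => ((‖indicatorConstLp 2 hs hμs (a : ℂ) x‖ : ℝ) : ℂ) := MemLp.coeFn_toLp _
  filter_upwards [habs, indicatorConstLp_coeFn (p := 2) (hs := hs) (hμs := hμs) (c := (a : ℂ))]
    with x h1 h2
  rw [h1, h2]
  by_cases hx : x ∈ s <;> simp [hx, abs_of_nonneg ha]

theorem exists_mem_ae_eq_sum {κ : Type*} (K : Submodule ℂ (Lp ℂ 2 μ)) (s : Finset κ)
    (f : κ → X → ℂ) (h : ∀ y ∈ s, ∃ g ∈ K, g =ᵐ[μ] f y) :
    ∃ g ∈ K, g =ᵐ[μ] fun x => ∑ y ∈ s, f y x := by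
  classical
  induction s using Finset.induction_on with
  | empty =>
    refine ⟨0, K.zero_mem, ?_⟩
    filter_upwards [Lp.coeFn_zero ℂ 2 μ] with x hx
    rw [hx]
    simp
  | insert a s ha ih =>
    obtain ⟨g, hg, hg'⟩ := ih fun y hy => h y (Finset.mem_insert_of_mem hy)
    obtain ⟨k, hk, hk'⟩ := h a (Finset.mem_insert_self a s)
    refine ⟨k + g, K.add_mem hk hg, ?_⟩
    filter_upwards [Lp.coeFn_add k g, hg', hk'] with x h1 h2 h3
    rw [h1, Pi.add_apply, h2, h3, Finset.sum_insert ha]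

/-- Finitely many elements of `L²` are approximated simultaneously in the span of an orthonormal
family of normalized indicator functions of disjoint sets. -/
theorem exists_orthonormal_indicator_approx (F : Finset (Lp ℂ 2 μ)) {ε : ℝ} (hε : 0 < ε) :
    ∃ v : Set (Lp ℂ 2 μ), v.Finite ∧ Orthonormal ℂ ((↑) : v → Lp ℂ 2 μ) ∧
      (∀ e ∈ v, absL2 e = e) ∧ ∀ f ∈ F, ∃ g ∈ Submodule.span ℂ v, ‖f - g‖ < ε := by
  classical
  -- All of `F` is bundled into one function with values in `F → ℂ`. A single simple function then
  -- approximates every member, and its fibres are the disjoint sets.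
  have hF : MemLp (fun x (i : F) => (i : Lp ℂ 2 μ) x) 2 μ :=
    memLp_pi_iff.mpr fun i => Lp.memLp _
  obtain ⟨G, hG, hGm⟩ := hF.exists_simpleFunc_eLpNorm_sub_lt (by simp)
    (ε := ENNReal.ofReal ε) (by simpa using hε)
  have hfin : ∀ y, y ≠ 0 → μ (G ⁻¹' {y}) ≠ ∞ := fun y hy =>
    (SimpleFunc.measure_preimage_lt_top_of_memLp (by simp) (by simp) G hGm y hy).ne
  -- The fibre over `0` may have infinite measure, and null fibres cannot be normalized; neither
  -- contributes to `G` in `L²`.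
  let Y := {y // y ∈ G.range ∧ y ≠ 0 ∧ μ (G ⁻¹' {y}) ≠ 0}
  have hYfin : Finite Y := Finite.of_injective (β := G.range) (fun y => ⟨y.1, y.2.1⟩) fun y z h =>
    Subtype.ext (by simpa using h)
  let a : Y → ℝ := fun y => (Real.sqrt (μ.real (G ⁻¹' {y.1})))⁻¹
  have hpos : ∀ y : Y, 0 < μ.real (G ⁻¹' {y.1}) := fun y =>
    ENNReal.toReal_pos y.2.2.2 (hfin _ y.2.2.1)
  have ha : ∀ y, 0 < a y := fun y => inv_pos.mpr (Real.sqrt_pos.mpr (hpos y))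
  let e : Y → Lp ℂ 2 μ := fun y =>
    indicatorConstLp 2 (G.measurableSet_fiber y.1) (hfin _ y.2.2.1) (a y : ℂ)
  have he : Orthonormal ℂ e := by
    rw [orthonormal_iff_ite]
    intro y z
    rw [L2.inner_indicatorConstLp_indicatorConstLp _ _ (hfin _ y.2.2.1) (hfin _ z.2.2.1)]
    split_ifs with h
    · subst h
      have h1 : μ.real (G ⁻¹' {y.1}) * (a y * a y) = 1 := by
        have h2 := Real.mul_self_sqrt (hpos y).le
        have h3 := (Real.sqrt_pos.mpr (hpos y)).ne'
        simp only [a]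
        field_simp
        rw [sq, h2]
      rw [Set.inter_self, Complex.real_smul]
      have h4 : (inner ℂ (a y : ℂ) (a y : ℂ) : ℂ) = ((a y * a y : ℝ) : ℂ) := by
        rw [RCLike.inner_apply, Complex.conj_ofReal, ← Complex.ofReal_mul]
      rw [h4, ← Complex.ofReal_mul, h1, Complex.ofReal_one]
    · have : G ⁻¹' {y.1} ∩ G ⁻¹' {z.1} = ∅ := by
        ext x
        simp only [Set.mem_inter_iff, Set.mem_preimage, Set.mem_singleton_iff,
          Set.mem_empty_iff_false, iff_false, not_and]
        exact fun h1 h2 => h (Subtype.ext (h1.symm.trans h2))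
      rw [this]
      simp
  refine ⟨Set.range e, Set.finite_range e, he.toSubtypeRange, ?_, ?_⟩
  · rintro _ ⟨y, rfl⟩
    exact absL2_indicatorConstLp _ _ (ha y).le
  · intro f hf
    obtain ⟨g, hg, hg'⟩ := exists_mem_ae_eq_sum (Submodule.span ℂ (Set.range e)) G.range
      (fun y => (G ⁻¹' {y}).indicator fun _ => y ⟨f, hf⟩) (by
        intro y hy
        by_cases hy0 : y = 0
        · refine ⟨0, zero_mem _, ?_⟩
          filter_upwards [Lp.coeFn_zero ℂ 2 μ] with x hx
          rw [hx]
          simp [hy0]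
        by_cases hμ : μ (G ⁻¹' {y}) = 0
        · refine ⟨0, zero_mem _, ?_⟩
          filter_upwards [Lp.coeFn_zero ℂ 2 μ, measure_eq_zero_iff_ae_notMem.mp hμ] with x hx hx'
          rw [hx, Set.indicator_of_notMem hx']
          rfl
        · let y' : Y := ⟨y, hy, hy0, hμ⟩
          refine ⟨(y ⟨f, hf⟩ / (a y' : ℂ)) • e y',
            Submodule.smul_mem _ _ (Submodule.subset_span ⟨y', rfl⟩), ?_⟩
          have hane : (a y' : ℂ) ≠ 0 := by exact_mod_cast (ha y').ne'
          filter_upwards [Lp.coeFn_smul (y ⟨f, hf⟩ / (a y' : ℂ)) (e y'),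
            indicatorConstLp_coeFn (p := 2) (hs := G.measurableSet_fiber y)
              (hμs := hfin y hy0) (c := (a y' : ℂ))] with x h1 h2
          rw [h1, Pi.smul_apply]
          change _ • (indicatorConstLp 2 _ _ (a y' : ℂ) : Lp ℂ 2 μ) x = _
          rw [h2]
          by_cases hx : x ∈ G ⁻¹' {y}
          · rw [Set.indicator_of_mem hx, Set.indicator_of_mem hx, smul_eq_mul,
              div_mul_cancel₀ _ hane]
          · rw [Set.indicator_of_notMem hx, Set.indicator_of_notMem hx, smul_zero])
    refine ⟨g, hg, ?_⟩
    have hgG : ∀ᵐ x ∂μ, g x = G x ⟨f, hf⟩ := by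
      filter_upwards [hg'] with x hx
      rw [hx, Finset.sum_eq_single (G x)]
      · simp
      · intro y _ hy
        exact Set.indicator_of_notMem (fun h => hy (by simpa using h.symm)) _
      · intro h
        exact absurd (G.mem_range_self x) h
    rw [Lp.norm_def]
    have hle : eLpNorm (f - g : Lp ℂ 2 μ) 2 μ ≤
        eLpNorm ((fun x (i : F) => (i : Lp ℂ 2 μ) x) - ⇑G) 2 μ := by
      -- Each coordinate is bounded by the sup norm on `F → ℂ`.
      refine eLpNorm_mono_ae ?_
      filter_upwards [Lp.coeFn_sub f g, hgG] with x h1 h2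
      rw [h1, Pi.sub_apply, h2]
      exact norm_le_pi_norm (((fun x (i : F) => (i : Lp ℂ 2 μ) x) - ⇑G) x) ⟨f, hf⟩
    have h := (hle.trans_lt hG)
    rw [← ENNReal.toReal_ofReal hε.le]
    exact (ENNReal.toReal_lt_toReal (ne_top_of_lt h) ENNReal.ofReal_ne_top).mpr h

/-- Semigroup domination implies an inequality between the heat traces. -/
theorem trace_heat_le_of_dominates {H M : Lp ℂ 2 μ →ₗ.[ℂ] Lp ℂ 2 μ}
    (hH : IsSelfAdjoint H) (hH0 : IsNonneg H) (hM : IsSelfAdjoint M) (hM0 : IsNonneg M)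
    (hdom : Dominates H M) {t : ℝ} (ht : 0 < t) : trace (heat M t) ≤ trace (heat H t) := by
  refine trace_le_trace_of_approx (isPositive_functionOf hH hH0 fun s _ => (Real.exp_pos _).le)
    (isPositive_functionOf hM hM0 fun s _ => (Real.exp_pos _).le)
    (p := fun e => absL2 e = e) (fun e he => ?_)
    (fun F ε hε => exists_orthonormal_indicator_approx F hε)
  have h := re_inner_le_of_dominates (hdom e t ht)
  rwa [he] at h

end L2

/-! ### Heat trace of `H` by Laplace transform, for positive exponents. -/

section Hilbert

variable {E : Type*} [NormedAddCommGroup E] [InnerProductSpace ℂ E] [CompleteSpace E]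

/-- The integrand vanishes for `l ≤ s`, as `0 ^ γ = 0` for `γ > 0`, and `s ≥ 0` keeps the rest
inside the half-line. The translation `x = l - s` leaves a Gamma integral. -/
theorem integral_negPart_rpow_mul_exp {γ t s : ℝ} (hγ : 0 < γ) (ht : 0 < t) (hs : 0 ≤ s) :
    ∫ l in Set.Ioi (0 : ℝ), Real.exp (-(t * l)) * (max (l - s) 0) ^ γ
      = (1 / t) ^ (γ + 1) * Real.Gamma (γ + 1) * Real.exp (-(t * s)) := by
  have h1 : ∀ l : ℝ, (Set.Ioi (0 : ℝ)).indicator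
      (fun l => Real.exp (-(t * l)) * (max (l - s) 0) ^ γ) l
      = (Set.Ioi (0 : ℝ)).indicator
        (fun x => Real.exp (-(t * s)) * (x ^ (γ + 1 - 1) * Real.exp (-(t * x)))) (l - s) := by
    intro l
    rcases le_or_gt l s with h | h
    · rw [Set.indicator_of_notMem (s := Set.Ioi (0 : ℝ)) (a := l - s) (by simpa using h)]
      have h0 : max (l - s) 0 ^ γ = 0 := by
        rw [max_eq_right (by linarith), Real.zero_rpow hγ.ne']
      simp [Set.indicator, h0]
    · rw [Set.indicator_of_mem (s := Set.Ioi (0 : ℝ)) (a := l - s) (by simpa using h),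
        Set.indicator_of_mem (s := Set.Ioi (0 : ℝ)) (a := l) (lt_of_le_of_lt hs h),
        max_eq_left (by linarith), mul_comm (_ ^ (γ + 1 - 1)), ← mul_assoc, ← Real.exp_add]
      congr 2 <;> ring
  rw [← integral_indicator measurableSet_Ioi, funext h1,
    integral_sub_right_eq_self (fun x => (Set.Ioi (0 : ℝ)).indicator
        (fun x => Real.exp (-(t * s)) * (x ^ (γ + 1 - 1) * Real.exp (-(t * x)))) x) s,
    integral_indicator measurableSet_Ioi, integral_const_mul,
    Real.integral_rpow_mul_exp_neg_mul_Ioi (by linarith) ht]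
  ring

theorem integrableOn_exp_mul_rpow {α t : ℝ} (hα : 0 ≤ α) (ht : 0 < t) :
    IntegrableOn (fun l => Real.exp (-(t * l)) * l ^ α) (Set.Ioi 0) := by
  refine (integrableOn_rpow_mul_exp_neg_mul_rpow (s := α) (p := 1) (by linarith) one_pos ht).congr_fun
    (fun l _ => ?_) measurableSet_Ioi
  simp [mul_comm]

theorem negPartPow_of_pos (H : E →ₗ.[ℂ] E) (lam : ℝ) {γ : ℝ} (hγ : 0 < γ) :
    negPartPow H lam γ = functionOf H (fun s => (max (lam - s) 0) ^ γ) := by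
  rw [negPartPow, if_neg hγ.ne']

/-- The heat semigroup as a Laplace transform of the operators `(H - lam)₋ ^ γ`, in the sense of
quadratic forms. -/
theorem integral_negPartPow_form {H : E →ₗ.[ℂ] E} (hH : IsSelfAdjoint H) (h0 : IsNonneg H)
    {γ t : ℝ} (hγ : 0 < γ) (ht : 0 < t) (u : E) :
    IntegrableOn (fun l => Real.exp (-(t * l)) * (inner ℂ u (negPartPow H l γ u)).re)
      (Set.Ioi 0) ∧
    ∫ l in Set.Ioi (0 : ℝ), Real.exp (-(t * l)) * (inner ℂ u (negPartPow H l γ u)).re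
      = (1 / t) ^ (γ + 1) * Real.Gamma (γ + 1) * (inner ℂ u (heat H t u)).re := by
  have hs := spectrum_inverseOneAdd_subset hH h0
  have hsa := isSelfAdjoint_inverseOneAdd hH h0
  let f : ℝ → ℝ → ℝ := fun l => pullback fun s => Real.exp (-(t * l)) * (max (l - s) 0) ^ γ
  have hf : ContinuousOn (Function.uncurry f)
      (Set.Ioi 0 ×ˢ spectrum ℝ (inverseOneAdd H)) := by
    have h1 : ContinuousOn (fun p : ℝ × ℝ => Real.exp (-(t * p.1)) *
        pullback (fun s => (max (p.1 - s) 0) ^ γ) p.2) (Set.univ ×ˢ Set.Icc 0 1) :=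
      ContinuousOn.mul (by fun_prop) (continuousOn_pullback_negPart_rpow_uncurry hγ)
    refine (h1.mono (Set.prod_mono (Set.subset_univ _) hs)).congr fun p _ => ?_
    exact congrFun (pullback_const_mul (Real.exp (-(t * p.1))) fun s => (max (p.1 - s) 0) ^ γ) p.2
  -- Since `s ≥ 0`, `(l - s)₊ ≤ l` gives an integrable majorant independent of the spectral
  -- variable.
  have hbd : ∀ᵐ l ∂(volume.restrict (Set.Ioi (0 : ℝ))),
      ∀ z ∈ spectrum ℝ (inverseOneAdd H), ‖f l z‖ ≤ Real.exp (-(t * l)) * l ^ γ := by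
    refine ae_restrict_of_forall_mem measurableSet_Ioi fun l hl z hz => ?_
    have hl' : 0 < l := hl
    have h1 : 0 ≤ f l z := by
      simp only [f, pullback]
      split_ifs <;> positivity
    rw [Real.norm_of_nonneg h1]
    simp only [f, pullback]
    split_ifs with hz0
    · positivity
    · gcongr
      refine max_le ?_ hl'.le
      have : 0 < z := lt_of_le_of_ne (hs hz).1 (Ne.symm hz0)
      have : 1 ≤ 1 / z := by rw [le_div_iff₀ this]; linarith [(hs hz).2]
      linarith
  have hint := (integrableOn_exp_mul_rpow hγ.le ht).hasFiniteIntegral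
  have hI := integrableOn_cfc measurableSet_Ioi f _ (inverseOneAdd H) hf hbd hint hsa
  have hE := cfc_setIntegral measurableSet_Ioi f _ (inverseOneAdd H) hf hbd hint hsa
  have hcfc : ∀ l, cfc (f l) (inverseOneAdd H) = Real.exp (-(t * l)) • negPartPow H l γ := by
    intro l
    rw [negPartPow_of_pos H l hγ, ← functionOf_const_mul hH h0 _
      (continuousOn_pullback_negPart_rpow hγ l)]
    rfl
  have hleft : cfc (fun r => ∫ l in Set.Ioi 0, f l r) (inverseOneAdd H)
      = ((1 / t) ^ (γ + 1) * Real.Gamma (γ + 1)) • heat H t := by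
    rw [heat, ← functionOf_const_mul hH h0 _ (continuousOn_pullback_exp ht), functionOf_eq]
    refine cfc_congr fun r hr => ?_
    simp only [f, pullback]
    split_ifs with hr0
    · simp
    · refine integral_negPart_rpow_mul_exp hγ ht ?_
      have : 0 < r := lt_of_le_of_ne (hs hr).1 (Ne.symm hr0)
      have : 1 ≤ 1 / r := by rw [le_div_iff₀ this]; linarith [(hs hr).2]
      linarith
  -- The quadratic form at `u` is a continuous real-linear functional of the operator, so it
  -- commutes with the operator-valued integral.
  let L : (E →L[ℂ] E) →L[ℝ] ℝ := Complex.reCLM ∘L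
    ((innerSL ℂ u ∘L ContinuousLinearMap.apply ℂ E u).restrictScalars ℝ)
  have hL : ∀ T : E →L[ℂ] E, L T = (inner ℂ u (T u)).re := fun T => rfl
  have hLf : ∀ l, L (cfc (f l) (inverseOneAdd H))
      = Real.exp (-(t * l)) * (inner ℂ u (negPartPow H l γ u)).re := by
    intro l
    rw [hcfc, map_smul, hL, smul_eq_mul]
  simp only [← hLf]
  refine ⟨L.integrable_comp hI, ?_⟩
  rw [L.integral_comp_comm hI, ← hE, hleft, map_smul, hL, smul_eq_mul]

theorem negPartPow_form_nonneg {H : E →ₗ.[ℂ] E} (hH : IsSelfAdjoint H) (h0 : IsNonneg H)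
    (lam : ℝ) {γ : ℝ} (hγ : 0 < γ) (u : E) : 0 ≤ (inner ℂ u (negPartPow H lam γ u)).re := by
  rw [negPartPow_of_pos H lam hγ]
  have h := (isPositive_functionOf hH h0 (φ := fun s => (max (lam - s) 0) ^ γ)
    fun s _ => by positivity).re_inner_nonneg_right u
  simpa using h

theorem heat_form_nonneg {H : E →ₗ.[ℂ] E} (hH : IsSelfAdjoint H) (h0 : IsNonneg H)
    (t : ℝ) (u : E) : 0 ≤ (inner ℂ u (heat H t u)).re := by
  have h := (isPositive_functionOf hH h0 (φ := fun s => Real.exp (-(t * s)))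
    fun s _ => (Real.exp_pos _).le).re_inner_nonneg_right u
  exact h

/-- For a finite partial trace, sum and Laplace integral commute; the hypothesis then applies under
the integral, uniformly in the finite set, and `∫₀^∞ e^{-tl} l^α dl` supplies `Γ(α+1)`. -/
theorem trace_heat_le_of_pos {H : E →ₗ.[ℂ] E} (hH : IsSelfAdjoint H) (h0 : IsNonneg H)
    {γ α C t : ℝ} (hγ : 0 < γ) (hα : 0 ≤ α) (hC : 0 < C) (ht : 0 < t)
    (hbound : ∀ lam : ℝ, 0 ≤ lam →
      trace (negPartPow H lam γ) ≤ ENNReal.ofReal (C * lam ^ α)) :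
    trace (heat H t) ≤ ENNReal.ofReal
      (C * (Real.Gamma (α + 1) / Real.Gamma (γ + 1)) * t ^ (γ - α)) := by
  have hG : 0 < Real.Gamma (γ + 1) := Real.Gamma_pos_of_pos (by linarith)
  rw [trace, ENNReal.tsum_eq_iSup_sum]
  refine iSup_le fun F => ?_
  rw [← ENNReal.ofReal_sum_of_nonneg fun i _ => heat_form_nonneg hH h0 t _]
  refine ENNReal.ofReal_le_ofReal ?_
  have hsum : ∫ l in Set.Ioi (0 : ℝ), ∑ e ∈ F,
      Real.exp (-(t * l)) * (inner ℂ (e : E) (negPartPow H l γ e)).re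
      ≤ ∫ l in Set.Ioi (0 : ℝ), C * (Real.exp (-(t * l)) * l ^ α) := by
    refine setIntegral_mono_on
      (integrable_finsetSum _ fun e _ => (integral_negPartPow_form hH h0 hγ ht (e : E)).1)
      ((integrableOn_exp_mul_rpow hα ht).const_mul C) measurableSet_Ioi fun l hl => ?_
    have hl' : 0 < l := hl
    rw [← Finset.mul_sum, mul_left_comm]
    refine mul_le_mul_of_nonneg_left ?_ (Real.exp_pos _).le
    rw [← ENNReal.ofReal_le_ofReal_iff (by positivity),
      ENNReal.ofReal_sum_of_nonneg fun i _ => negPartPow_form_nonneg hH h0 l hγ _]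
    exact (ENNReal.sum_le_tsum F).trans (hbound l hl'.le)
  rw [integral_finsetSum F fun e _ => (integral_negPartPow_form hH h0 hγ ht (e : E)).1,
    Finset.sum_congr (s₁ := F) rfl fun e _ =>
      (integral_negPartPow_form hH h0 hγ ht (e : E)).2,
    ← Finset.mul_sum, integral_const_mul] at hsum
  have hI : ∫ l in Set.Ioi (0 : ℝ), Real.exp (-(t * l)) * l ^ α
      = (1 / t) ^ (α + 1) * Real.Gamma (α + 1) := by
    rw [← Real.integral_rpow_mul_exp_neg_mul_Ioi (by linarith) ht]
    simp [mul_comm]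
  rw [hI] at hsum
  have hpow : C * (Real.Gamma (α + 1) / Real.Gamma (γ + 1)) * t ^ (γ - α)
      = C * ((1 / t) ^ (α + 1) * Real.Gamma (α + 1)) /
        ((1 / t) ^ (γ + 1) * Real.Gamma (γ + 1)) := by
    have h1 : t ^ (γ - α) = (1 / t) ^ (α + 1) / (1 / t) ^ (γ + 1) := by
      rw [← Real.rpow_sub (by positivity), one_div, Real.inv_rpow ht.le, ← Real.rpow_neg ht.le]
      congr 1
      ring
    have h2 : (0 : ℝ) < (1 / t) ^ (γ + 1) := by positivity
    rw [h1]
    field_simp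
  rw [hpow, le_div_iff₀ (by positivity), mul_comm]
  exact hsum

/-! ### The spectral projection and the limit exponent `γ = 0`. -/

theorem functionOf_add {H : E →ₗ.[ℂ] E} (hH : IsSelfAdjoint H) (h0 : IsNonneg H)
    {φ ψ : ℝ → ℝ} (hφ : ContinuousOn (pullback φ) (Set.Icc 0 1))
    (hψ : ContinuousOn (pullback ψ) (Set.Icc 0 1)) :
    ContinuousOn (pullback fun s => φ s + ψ s) (Set.Icc 0 1) ∧
    functionOf H (fun s => φ s + ψ s) = functionOf H φ + functionOf H ψ := by
  have hs := spectrum_inverseOneAdd_subset hH h0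
  have h : (pullback fun s => φ s + ψ s) = fun r => pullback φ r + pullback ψ r := by
    ext r
    unfold pullback
    split_ifs <;> simp
  rw [functionOf_eq, functionOf_eq, functionOf_eq, ← cfc_add _ _ _ (hφ.mono hs) (hψ.mono hs), h]
  exact ⟨hφ.add hψ, rfl⟩

/-- A form-null vector of a positive operator is in its kernel. -/
theorem apply_eq_zero_of_form_le_zero {T : E →L[ℂ] E} (hT : T.IsPositive) {x : E}
    (hx : (inner ℂ x (T x)).re ≤ 0) : T x = 0 := by
  have hnn : 0 ≤ T := (ContinuousLinearMap.nonneg_iff_isPositive T).mpr hT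
  obtain ⟨S, hS, rfl⟩ : ∃ S : E →L[ℂ] E, IsSelfAdjoint S ∧ S * S = T :=
    ⟨CFC.sqrt T, (CFC.sqrt_nonneg T).isSelfAdjoint, CFC.sqrt_mul_sqrt_self T hnn⟩
  have hsymm : inner ℂ (S x) (S x) = inner ℂ x (S (S x)) :=
    (ContinuousLinearMap.isSelfAdjoint_iff_isSymmetric.mp hS) x (S x)
  have h1 : ‖S x‖ ^ 2 ≤ 0 := by
    have := inner_self_eq_norm_sq (𝕜 := ℂ) (S x)
    rw [hsymm] at this
    rw [← this]
    exact hx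
  have h2 : S x = 0 := by
    rw [← norm_eq_zero]
    exact pow_eq_zero_iff two_ne_zero |>.mp (le_antisymm h1 (sq_nonneg _))
  rw [mul_apply_eq_comp, h2, map_zero]

/-- Elementary bound of a power by a small multiple of a positive function and a linear term. -/
theorem exists_negPart_rpow_le {γ ε lam : ℝ} (hγ : 0 < γ) (hε : 0 < ε) (hl : 0 ≤ lam) :
    ∃ D : ℝ, ∀ s : ℝ, 0 ≤ s →
      (max (lam - s) 0) ^ γ ≤ ε * Real.exp (-(1 * s)) + D * max (lam - s) 0 := by
  -- Where the negative part `m` is positive one has `s < lam`, hence `η ≤ ε e^{-s}`. The threshold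
  -- `δ` solves `δ ^ γ = η`: for `m ≤ δ` the exponential suffices, for `m > δ` the linear term with
  -- `D = lam ^ γ / δ`.
  set η := ε * Real.exp (-lam) with hη
  have hη0 : 0 < η := by positivity
  set δ := η ^ (1 / γ) with hδ
  have hδ0 : 0 < δ := by positivity
  refine ⟨lam ^ γ / δ, fun s hs => ?_⟩
  set m := max (lam - s) 0 with hm
  have hm0 : 0 ≤ m := le_max_right _ _
  have hml : m ≤ lam := max_le (by linarith) hl
  have hlp : 0 ≤ lam ^ γ := by positivity
  rcases hm0.eq_or_lt with h | h
  · rw [← h, Real.zero_rpow hγ.ne']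
    positivity
  · have hsl : s < lam := by
      by_contra hcon
      rw [hm, max_eq_right (by linarith)] at h
      exact lt_irrefl _ h
    rcases le_or_gt m δ with h1 | h1
    · have h2 : m ^ γ ≤ η := by
        calc m ^ γ ≤ δ ^ γ := Real.rpow_le_rpow hm0 h1 hγ.le
          _ = η := by rw [hδ, ← Real.rpow_mul hη0.le, one_div_mul_cancel hγ.ne', Real.rpow_one]
      have h3 : η ≤ ε * Real.exp (-(1 * s)) := by
        rw [hη]
        gcongr
        linarith
      have h4 : 0 ≤ lam ^ γ / δ * m := by positivity
      linarith
    · have h2 : m ^ γ ≤ lam ^ γ := Real.rpow_le_rpow hm0 hml hγ.le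
      have h3 : lam ^ γ ≤ lam ^ γ / δ * m := by
        rw [div_mul_eq_mul_div, le_div_iff₀ hδ0]
        gcongr
      have h4 : 0 ≤ ε * Real.exp (-(1 * s)) := by positivity
      linarith

/-- With `mem_orthogonal_of_negPart_apply_eq_zero` this identifies the complement of the spectral
subspace with the kernel of `(H - lam)₋`, which replaces a Borel functional calculus below. -/
theorem negPart_apply_eq_zero {H : E →ₗ.[ℂ] E} (hH : IsSelfAdjoint H) (h0 : IsNonneg H)
    {lam : ℝ} {q : E} (hq : q ∈ (spectralSubspaceBelow H lam)ᗮ) :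
    functionOf H (fun s => max (lam - s) 0) q = 0 := by
  have hN := isPositive_functionOf hH h0 (φ := fun s => max (lam - s) 0) fun s _ => by positivity
  refine apply_eq_zero_of_form_le_zero hN (le_of_eq ?_)
  exact congrArg Complex.re ((Submodule.mem_orthogonal' _ _).mp hq _
    (Submodule.le_topologicalClosure _ (LinearMap.mem_range_self _ q)))

theorem mem_orthogonal_of_negPart_apply_eq_zero {H : E →ₗ.[ℂ] E} (hH : IsSelfAdjoint H)
    (h0 : IsNonneg H) {lam : ℝ} {q : E} (hq : functionOf H (fun s => max (lam - s) 0) q = 0) :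
    q ∈ (spectralSubspaceBelow H lam)ᗮ := by
  have hN := isPositive_functionOf hH h0 (φ := fun s => max (lam - s) 0) fun s _ => by positivity
  rw [spectralSubspaceBelow, Submodule.orthogonal_closure, Submodule.mem_orthogonal]
  rintro _ ⟨v, rfl⟩
  have h := hN.inner_left_eq_inner_right v q
  change inner ℂ (functionOf H (fun s => max (lam - s) 0) v) q = 0
  rw [h, hq, inner_zero_right]

omit [CompleteSpace E] in
theorem starProjection_form (K : Submodule ℂ E) [K.HasOrthogonalProjection] (u : E) :
    (inner ℂ u (K.starProjection u)).re = ‖K.starProjection u‖ ^ 2 := by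
  have h : inner ℂ u (K.starProjection u)
      = inner ℂ (K.starProjection u) (K.starProjection u) := by
    conv_lhs => rw [← K.starProjection_eq_self_iff.mpr (K.starProjection_apply_mem u)]
    exact (Submodule.inner_starProjection_left_eq_right K u _).symm
  rw [h]
  have := inner_self_eq_norm_sq (𝕜 := ℂ) (K.starProjection u)
  simpa using this

theorem negPartPow_zero (H : E →ₗ.[ℂ] E) (lam : ℝ) :
    negPartPow H lam 0 = (spectralSubspaceBelow H lam).starProjection := by
  rw [negPartPow, if_pos rfl]

/-- Since `H ≥ 0`, the operator `T = (H - lam)₋^γ` has norm at most `lam ^ γ`, and it kills `Kᗮ`, so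
only the projection of `u` to `K` matters. It kills `Kᗮ` because `T ≤ ε e^{-H} + D (H - lam)₋` for
every `ε > 0`, and the last term vanishes there. -/
theorem negPartPow_form_le {H : E →ₗ.[ℂ] E} (hH : IsSelfAdjoint H) (h0 : IsNonneg H)
    {γ lam : ℝ} (hγ : 0 < γ) (hl : 0 ≤ lam) (u : E) :
    (inner ℂ u (negPartPow H lam γ u)).re
      ≤ lam ^ γ * (inner ℂ u (negPartPow H lam 0 u)).re := by
  have hs := spectrum_inverseOneAdd_subset hH h0
  rw [negPartPow_of_pos H lam hγ, negPartPow_zero, starProjection_form]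
  set K := spectralSubspaceBelow H lam
  set T := functionOf H (fun s => (max (lam - s) 0) ^ γ) with hTdef
  have hT : T.IsPositive := isPositive_functionOf hH h0 fun s _ => by positivity
  have hnorm : ‖T‖ ≤ lam ^ γ := by
    refine norm_cfc_le (by positivity) fun r hr => ?_
    change ‖pullback (fun s => (max (lam - s) 0) ^ γ) r‖ ≤ _
    unfold pullback
    split_ifs with hr0
    · rw [norm_zero]; positivity
    · rw [Real.norm_of_nonneg (by positivity)]
      refine Real.rpow_le_rpow (le_max_right _ _) (max_le ?_ hl) hγ.le
      have : 0 < r := lt_of_le_of_ne (hs hr).1 (Ne.symm hr0)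
      have : 1 ≤ 1 / r := by rw [le_div_iff₀ this]; linarith [(hs hr).2]
      linarith
  have hker : T (u - K.starProjection u) = 0 := by
    set q := u - K.starProjection u
    have hq : q ∈ Kᗮ := K.sub_starProjection_mem_orthogonal u
    refine apply_eq_zero_of_form_le_zero hT ?_
    refine le_of_forall_pos_le_add fun ε hε => ?_
    set h := (inner ℂ q (heat H 1 q)).re with hh
    have hh0 : 0 ≤ h := heat_form_nonneg hH h0 1 q
    -- Dividing by `h + 1` makes the heat term at most `ε` even when `h = 0`.
    obtain ⟨D, hD⟩ := exists_negPart_rpow_le (ε := ε / (h + 1)) hγ (by positivity) hl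
    have c1 := continuousOn_pullback_const_mul (ε / (h + 1)) (continuousOn_pullback_exp one_pos)
    have c2 := continuousOn_pullback_const_mul D (continuousOn_pullback_negPart lam)
    obtain ⟨c3, h3⟩ := functionOf_add hH h0 c1 c2
    have h4 := re_inner_le_of_le
      (functionOf_mono hH h0 (continuousOn_pullback_negPart_rpow hγ lam) c3 hD) q
    rw [h3, functionOf_const_mul hH h0 _ (continuousOn_pullback_exp one_pos),
      functionOf_const_mul hH h0 _ (continuousOn_pullback_negPart lam)] at h4
    have h5 : ((ε / (h + 1)) • functionOf H (fun s => Real.exp (-(1 * s))) +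
        D • functionOf H (fun s => max (lam - s) 0)) q = (ε / (h + 1)) • heat H 1 q := by
      change (ε / (h + 1)) • functionOf H (fun s => Real.exp (-(1 * s))) q +
        D • functionOf H (fun s => max (lam - s) 0) q = _
      rw [negPart_apply_eq_zero hH h0 hq, smul_zero, add_zero]
      rfl
    rw [h5, inner_smul_right_eq_smul, Complex.smul_re, smul_eq_mul, ← hh] at h4
    refine h4.trans ?_
    rw [zero_add, div_mul_eq_mul_div, div_le_iff₀ (by positivity)]
    nlinarith
  set p := K.starProjection u
  have hTu : T u = T p := by
    rw [map_sub, sub_eq_zero] at hker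
    exact hker
  have h1 : inner ℂ u (T u) = inner ℂ (T p) p := by
    rw [hTu, ← hT.inner_left_eq_inner_right, hTu]
  rw [h1]
  calc (inner ℂ (T p) p).re ≤ ‖T p‖ * ‖p‖ :=
        (Complex.re_le_norm _).trans (norm_inner_le_norm _ _)
    _ ≤ (‖T‖ * ‖p‖) * ‖p‖ := by gcongr; exact T.le_opNorm p
    _ ≤ (lam ^ γ * ‖p‖) * ‖p‖ := by gcongr
    _ = _ := by ring

/-- For `γ = 0`, `negPartPow_form_le` converts the hypothesis into `tr (H - l)₋^η ≤ C l^{α+η}`. The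
exponent of `t` stays `η - (α + η) = -α`, and continuity of `Γ` allows `η → 0`. -/
theorem trace_heat_le {H : E →ₗ.[ℂ] E} (hH : IsSelfAdjoint H) (h0 : IsNonneg H)
    {γ α C t : ℝ} (hγ : 0 ≤ γ) (hα : 0 ≤ α) (hC : 0 < C) (ht : 0 < t)
    (hbound : ∀ lam : ℝ, 0 ≤ lam →
      trace (negPartPow H lam γ) ≤ ENNReal.ofReal (C * lam ^ α)) :
    trace (heat H t) ≤ ENNReal.ofReal
      (C * (Real.Gamma (α + 1) / Real.Gamma (γ + 1)) * t ^ (γ - α)) := by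
  rcases hγ.eq_or_lt with rfl | hγ
  swap
  · exact trace_heat_le_of_pos hH h0 hγ hα hC ht hbound
  have key : ∀ η : ℝ, 0 < η → trace (heat H t) ≤ ENNReal.ofReal
      (C * (Real.Gamma (α + η + 1) / Real.Gamma (η + 1)) * t ^ (0 - α)) := by
    intro η hη
    have h := trace_heat_le_of_pos hH h0 (α := α + η) hη (by linarith) hC ht fun lam hl => ?_
    · have e : η - (α + η) = 0 - α := by ring
      rwa [e] at h
    · refine (trace_le_mul_trace (by positivity) (negPartPow_form_le hH h0 hη hl)).trans ?_
      refine (mul_le_mul_right (hbound lam hl) _).trans ?_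
      rw [← ENNReal.ofReal_mul (by positivity), Real.rpow_add_of_nonneg hl hα hη.le]
      exact ENNReal.ofReal_le_ofReal (by apply le_of_eq; ring)
  have g1 : ContinuousAt (fun η => Real.Gamma (α + η + 1)) 0 := by
    refine ContinuousAt.comp (g := Real.Gamma) ?_ (by fun_prop)
    exact (Real.differentiableAt_Gamma fun m h => by
      have : (0 : ℝ) ≤ m := m.cast_nonneg
      linarith).continuousAt
  have g2 : ContinuousAt (fun η => Real.Gamma (η + 1)) 0 := by
    refine ContinuousAt.comp (g := Real.Gamma) ?_ (by fun_prop)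
    exact (Real.differentiableAt_Gamma fun m h => by
      have : (0 : ℝ) ≤ m := m.cast_nonneg
      linarith).continuousAt
  have g3 : ContinuousAt (fun η => ENNReal.ofReal
      (C * (Real.Gamma (α + η + 1) / Real.Gamma (η + 1)) * t ^ (0 - α))) 0 := by
    refine ENNReal.continuous_ofReal.continuousAt.comp ?_
    exact (continuousAt_const.mul (g1.div g2 (by simp))).mul continuousAt_const
  have g4 := g3.tendsto.mono_left (nhdsWithin_le_nhds (s := Set.Ioi 0))
  rw [add_zero] at g4
  exact ge_of_tendsto g4 (by filter_upwards [self_mem_nhdsWithin] with η hη using key η hη)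

/-! ### From the heat trace of `M` back to `(M - lam)₋^γ`. -/

theorem rpow_le_mul_exp {γ y : ℝ} (hγ : 0 < γ) (hy : 0 ≤ y) :
    y ^ γ ≤ (γ / Real.exp 1) ^ γ * Real.exp y := by
  have h1 : y ≤ γ / Real.exp 1 * Real.exp (y / γ) := by
    -- Equality holds at `y = γ`, so `(γ/e)^γ` is the maximum of `y^γ e^{-y}`.
    have h := Real.add_one_le_exp (y / γ - 1)
    rw [sub_add_cancel, Real.exp_sub, div_le_iff₀ hγ] at h
    calc y ≤ _ := h
      _ = _ := by ring
  calc y ^ γ ≤ (γ / Real.exp 1 * Real.exp (y / γ)) ^ γ := Real.rpow_le_rpow hy h1 hγ.le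
    _ = _ := by
      rw [Real.mul_rpow (by positivity) (by positivity), ← Real.exp_mul, div_mul_cancel₀ _ hγ.ne']

theorem negPart_rpow_le_mul_exp {γ t s lam : ℝ} (hγ : 0 < γ) (ht : 0 < t) :
    (max (lam - s) 0) ^ γ
      ≤ Real.exp (t * lam) * (γ / Real.exp 1) ^ γ * t ^ (-γ) * Real.exp (-(t * s)) := by
  rcases le_or_gt (lam - s) 0 with h | h
  · rw [max_eq_right h, Real.zero_rpow hγ.ne']
    positivity
  · rw [max_eq_left h.le]
    have h1 := rpow_le_mul_exp hγ (y := t * (lam - s)) (by positivity)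
    rw [Real.mul_rpow ht.le h.le] at h1
    have h2 : Real.exp (t * (lam - s)) = Real.exp (t * lam) * Real.exp (-(t * s)) := by
      rw [← Real.exp_add]; congr 1; ring
    have h3 : t ^ (-γ) * t ^ γ = 1 := by rw [← Real.rpow_add ht]; simp
    calc (lam - s) ^ γ = t ^ (-γ) * (t ^ γ * (lam - s) ^ γ) := by
          rw [← mul_assoc, h3, one_mul]
      _ ≤ t ^ (-γ) * ((γ / Real.exp 1) ^ γ * Real.exp (t * (lam - s))) := by gcongr
      _ = _ := by rw [h2]; ring

/-- On the spectral subspace below `lam`, the heat operator is at least `exp (-t lam)`. -/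
theorem norm_sq_le_heat_form {M : E →ₗ.[ℂ] E} (hM : IsSelfAdjoint M) (h0 : IsNonneg M)
    {t lam : ℝ} (ht : 0 < t) {p : E} (hp : p ∈ spectralSubspaceBelow M lam) :
    ‖p‖ ^ 2 ≤ Real.exp (t * lam) * (inner ℂ p (heat M t p)).re := by
  have hcl : IsClosed {p : E | ‖p‖ ^ 2 ≤ Real.exp (t * lam) * (inner ℂ p (heat M t p)).re} :=
    isClosed_le (by fun_prop) (by fun_prop)
  refine closure_minimal ?_ hcl hp
  rintro _ ⟨v, rfl⟩
  have cN := continuousOn_pullback_negPart lam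
  have cT := continuousOn_pullback_exp ht
  set N := functionOf M (fun s => max (lam - s) 0) with hNdef
  have hN : N.IsPositive := isPositive_functionOf hM h0 fun s _ => by positivity
  -- For `p = N v` the claim is a form inequality at `v`, coming from `m² ≤ e^{t lam} m e^{-ts} m`
  -- with `m = (lam - s)₊`, as `m = 0` unless `s < lam`.
  have hle : functionOf M (fun s => max (lam - s) 0 * max (lam - s) 0)
      ≤ functionOf M (fun s => Real.exp (t * lam) *
        (max (lam - s) 0 * (Real.exp (-(t * s)) * max (lam - s) 0))) := by
    refine functionOf_mono hM h0 (continuousOn_pullback_mul cN cN)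
      (continuousOn_pullback_const_mul _
        (continuousOn_pullback_mul cN (continuousOn_pullback_mul cT cN))) fun s _ => ?_
    rcases le_or_gt (lam - s) 0 with h | h
    · simp [max_eq_right h]
    · rw [max_eq_left h.le]
      have h1 : 1 ≤ Real.exp (t * lam) * Real.exp (-(t * s)) := by
        rw [← Real.exp_add]
        refine Real.one_le_exp ?_
        nlinarith
      nlinarith [mul_pos h h]
  have h1 := re_inner_le_of_le hle v
  rw [functionOf_const_mul hM h0 _ (continuousOn_pullback_mul cN (continuousOn_pullback_mul cT cN)),
    functionOf_mul hM h0 cN (continuousOn_pullback_mul cT cN), functionOf_mul hM h0 cT cN,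
    functionOf_mul hM h0 cN cN, ← hNdef] at h1
  have h2 : (inner ℂ v ((N * N) v)).re = ‖N v‖ ^ 2 := by
    rw [mul_apply_eq_comp, ← hN.inner_left_eq_inner_right]
    have := inner_self_eq_norm_sq (𝕜 := ℂ) (N v)
    simpa using this
  have h3 : (inner ℂ v ((Real.exp (t * lam) •
      (N * (functionOf M (fun s => Real.exp (-(t * s))) * N))) v)).re
      = Real.exp (t * lam) * (inner ℂ (N v) (heat M t (N v))).re := by
    rw [smul_apply, inner_smul_right_eq_smul, Complex.smul_re, smul_eq_mul,
      mul_apply_eq_comp, ← hN.inner_left_eq_inner_right]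
    rfl
  rw [h2, h3] at h1
  exact h1

/-- The heat operator commutes with `(M - lam)₋`, hence preserves its kernel `Kᗮ`. The cross terms
between `K` and `Kᗮ` vanish, and the part on `Kᗮ` is nonnegative and can be dropped. -/
theorem spectralProjection_form_le {M : E →ₗ.[ℂ] E} (hM : IsSelfAdjoint M) (h0 : IsNonneg M)
    {t : ℝ} (ht : 0 < t) (lam : ℝ) (u : E) :
    (inner ℂ u (negPartPow M lam 0 u)).re
      ≤ Real.exp (t * lam) * (inner ℂ u (heat M t u)).re := by
  rw [negPartPow_zero, starProjection_form]
  set K := spectralSubspaceBelow M lam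
  have hp : K.starProjection u ∈ K := K.starProjection_apply_mem u
  have hq : u - K.starProjection u ∈ Kᗮ := K.sub_starProjection_mem_orthogonal u
  refine (norm_sq_le_heat_form hM h0 ht hp).trans
    (mul_le_mul_of_nonneg_left ?_ (Real.exp_pos _).le)
  set p := K.starProjection u
  set q := u - p with hqdef
  set T := heat M t with hTdef
  have hT : T.IsPositive := isPositive_functionOf hM h0 fun s _ => (Real.exp_pos _).le
  have hTq : T q ∈ Kᗮ := by
    refine mem_orthogonal_of_negPart_apply_eq_zero hM h0 ?_
    have hc : Commute (functionOf M (fun s => max (lam - s) 0)) T := cfc_commute_cfc _ _ _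
    have h := congrArg (fun S : E →L[ℂ] E => S q) hc.eq
    change functionOf M (fun s => max (lam - s) 0) (T q)
      = T (functionOf M (fun s => max (lam - s) 0) q) at h
    rw [h, negPart_apply_eq_zero hM h0 hq, map_zero]
  have hu : u = p + q := by rw [hqdef]; abel
  have h1 : inner ℂ p (T q) = 0 := (Submodule.mem_orthogonal _ _).mp hTq p hp
  have h2 : inner ℂ q (T p) = 0 := by
    rw [← hT.inner_left_eq_inner_right]
    exact (Submodule.mem_orthogonal' _ _).mp hTq p hp
  have h3 : 0 ≤ (inner ℂ q (T q)).re := heat_form_nonneg hM h0 t q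
  rw [hu, map_add, inner_add_left, inner_add_right, inner_add_right, h1, h2,
    add_zero, zero_add, Complex.add_re]
  linarith

theorem trace_negPartPow_le_trace_heat {M : E →ₗ.[ℂ] E} (hM : IsSelfAdjoint M)
    (h0 : IsNonneg M) {γ t : ℝ} (hγ : 0 ≤ γ) (ht : 0 < t) (lam : ℝ) :
    trace (negPartPow M lam γ)
      ≤ ENNReal.ofReal (Real.exp (t * lam) * (γ / Real.exp 1) ^ γ * t ^ (-γ))
        * trace (heat M t) := by
  rcases hγ.eq_or_lt with rfl | hγ
  · simpa using trace_le_mul_trace (Real.exp_pos _).le (spectralProjection_form_le hM h0 ht lam)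
  · refine trace_le_mul_trace (by positivity) fun u => ?_
    rw [negPartPow_of_pos M lam hγ]
    have cT := continuousOn_pullback_exp ht
    have h := re_inner_le_of_le (functionOf_mono hM h0 (continuousOn_pullback_negPart_rpow hγ lam)
      (continuousOn_pullback_const_mul _ cT) fun s _ => negPart_rpow_le_mul_exp hγ ht) u
    rwa [functionOf_const_mul hM h0 _ cT, smul_apply,
      inner_smul_right_eq_smul, Complex.smul_re, smul_eq_mul] at h

end Hilbert

end SemigroupDomination

/-! ### Optimization over the time `t`. -/

theorem theorem2p2 {X : Type*} [MeasurableSpace X] (μ : Measure X) [SigmaFinite μ]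
    (H M : Lp ℂ 2 μ →ₗ.[ℂ] Lp ℂ 2 μ)
    (hH : IsSelfAdjoint H) (hH0 : SemigroupDomination.IsNonneg H)
    (hM : IsSelfAdjoint M) (hM0 : SemigroupDomination.IsNonneg M)
    (hdom : SemigroupDomination.Dominates H M)
    (γ α C : ℝ) (hγ : 0 ≤ γ) (hγα : γ ≤ α) (hC : 0 < C)
    (hbound : ∀ lam : ℝ, 0 ≤ lam →
      SemigroupDomination.trace (SemigroupDomination.negPartPow H lam γ)
        ≤ ENNReal.ofReal (C * lam ^ α)) :
    ∀ lam : ℝ, 0 ≤ lam →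
      SemigroupDomination.trace (SemigroupDomination.negPartPow M lam γ)
        ≤ ENNReal.ofReal (C * (γ / Real.exp 1) ^ γ * (Real.exp 1 / α) ^ α
            * (Real.Gamma (α + 1) / Real.Gamma (γ + 1)) * lam ^ α) := by
  intro lam hl
  have hα : 0 ≤ α := hγ.trans hγα
  have key : ∀ t : ℝ, 0 < t →
      SemigroupDomination.trace (SemigroupDomination.negPartPow M lam γ)
        ≤ ENNReal.ofReal (C * (γ / Real.exp 1) ^ γ
            * (Real.Gamma (α + 1) / Real.Gamma (γ + 1)) * (Real.exp (t * lam) * t ^ (-α))) := by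
    intro t ht
    refine (SemigroupDomination.trace_negPartPow_le_trace_heat hM hM0 hγ ht lam).trans ?_
    refine (mul_le_mul_right ((SemigroupDomination.trace_heat_le_of_dominates hH hH0 hM hM0 hdom
      ht).trans (SemigroupDomination.trace_heat_le hH hH0 hγ hα hC ht hbound)) _).trans ?_
    rw [← ENNReal.ofReal_mul (by positivity)]
    refine ENNReal.ofReal_le_ofReal (le_of_eq ?_)
    have h1 : t ^ (-α) = t ^ (-γ) * t ^ (γ - α) := by
      rw [← Real.rpow_add ht]; congr 1; ring
    rw [h1]
    ring
  rcases hα.eq_or_lt with rfl | hα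
  -- For `α = 0` the factor `e^{t lam}` is optimal only as `t → 0`. Real powers satisfy `x ^ 0 = 1`
  -- also at `x = 0`, so `(e / 0) ^ 0 = 1` as the conventions require.
  · have h0 : γ = 0 := le_antisymm hγα hγ
    subst h0
    simp only [neg_zero, Real.rpow_zero, mul_one, zero_add, Real.Gamma_one, div_one] at key ⊢
    have hc : Filter.Tendsto (fun t : ℝ => ENNReal.ofReal (C * Real.exp (t * lam)))
        (nhdsWithin 0 (Set.Ioi 0)) (nhds (ENNReal.ofReal C)) := by
      have h1 : Continuous fun t : ℝ => ENNReal.ofReal (C * Real.exp (t * lam)) :=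
        ENNReal.continuous_ofReal.comp (by fun_prop)
      have h2 := (h1.tendsto 0).mono_left (nhdsWithin_le_nhds (s := Set.Ioi 0))
      simpa using h2
    exact ge_of_tendsto hc (by filter_upwards [self_mem_nhdsWithin] with t ht using key t ht)
  · rcases hl.eq_or_lt with rfl | hl
    -- For `lam = 0` and `α > 0` the bound `t ^ (-α)` tends to `0` as `t → ∞`.
    · rw [Real.zero_rpow hα.ne', mul_zero]
      have hc : Filter.Tendsto (fun t : ℝ => ENNReal.ofReal (C * (γ / Real.exp 1) ^ γ
            * (Real.Gamma (α + 1) / Real.Gamma (γ + 1)) * (Real.exp (t * 0) * t ^ (-α))))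
          Filter.atTop (nhds (ENNReal.ofReal 0)) := by
        refine (ENNReal.continuous_ofReal.tendsto 0).comp ?_
        have h := (tendsto_rpow_neg_atTop hα).const_mul (C * (γ / Real.exp 1) ^ γ
            * (Real.Gamma (α + 1) / Real.Gamma (γ + 1)))
        simpa using h
      exact ge_of_tendsto hc
        (by filter_upwards [Filter.eventually_gt_atTop 0] with t ht using key t ht)
    -- The minimizer of `e^{t lam} t^{-α}` is `t = α / lam`, with value `(e / α)^α lam^α`.
    · refine (key (α / lam) (by positivity)).trans (ENNReal.ofReal_le_ofReal (le_of_eq ?_))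
      rw [div_mul_cancel₀ _ hl.ne', Real.div_rpow (Real.exp_pos 1).le hα.le,
        Real.rpow_neg (by positivity), Real.div_rpow hα.le hl.le, ← Real.exp_mul, one_mul]
      have h1 : 0 < α ^ α := by positivity
      have h2 : 0 < lam ^ α := by positivity
      field_simp
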